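/- Let $n\ge 0$ and $f:\{0,1\}^n\times\{0,1\}^n\to\{0,1\}$. **Protocols.** All systems are finite-dimensional. Let $\Psi^+_{RQ}$ be the maximally entangled state of a reference qubit $R$ and an input qubit $Q$. In a (one-round non-local) protocol Alice and Bob share a pure resource state $|\Psi\rangle_{LE}$, Alice holding $L$ and Bob holding $E$, of Schmidt rank $d_E$. On input $x$ Alice applies a channel $\mathcal N^x_{QL\to M_0M_0'}$, keeps $M_0$ and sends $M_0'$ to Bob; on input $y$ Bob applies a channel $\mathcal M^y_{E\to M_1M_1'}$, keeps $M_1'$ and sends $M_1$ to Alice. Put $M=M_0M_1$ (held by Alice) and $M'=M_0'M_1'$ (held by Bob), and let $\rho_{RMM'}=\rho_{RMM'}(x,y)$ be the state after the exchange, when $Q$ is initially in the state $\Psi^+_{RQ}$ with $R$. With the fidelity $F(\rho,\sigma)=\operatorname{tr}\sqrt{\sqrt\sigma\rho\sqrt\sigma}$, the protocol is $(\varepsilon_0,\varepsilon_1)$-correct for $f$ if for all $(x,y)$: when $f(x,y)=0$ there is a channel $\mathcal D_{M\to Q}$ with $F(\mathcal D(\rho_{RM}),\Psi^+_{RQ})\ge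 1-\varepsilon_0$, and when $f(x,y)=1$ there is a channel $\mathcal D_{M'\to Q}$ with $F(\mathcal D(\rho_{RM'}),\Psi^+_{RQ})\ge 1-\varepsilon_1$. **Structure functions.** Let $$g(x,y)=\operatorname{tr}\Big(\rho_{RM'}-\tfrac{I}{2}\otimes\rho_{M'}\Big)^2,\qquad \tilde g(x,y)=\operatorname{tr}\Big(\rho_{RM}-\tfrac{I}{2}\otimes\rho_{M}\Big)^2,$$ regarded as real $2^n\times 2^n$ matrices. **Cost.** Let $C_{\varepsilon_0,\varepsilon_1}(f)$ be the infimum of $\log_2 d_E$ over all $(\varepsilon_0,\varepsilon_1)$-correct protocols for $f$ (with $\inf\emptyset=+\infty$), and let $FR_0(f)=C_{0,\,0.05}(f)$ and $FR_1(f)=C_{0.05,\,0}(f)$. For $h:\{0,1\}^n\times\{0,1\}^n\to\{0,1\}$ let $r(h)$ be the least rank of a real matrix $G$ with $G(x,y)=0\iff h(x,y)=0$. The convention $\log_2 0:=0$ is used (relevant only for zero matrices). **Claim.** 1. For every protocol, $\operatorname{rank} g\le d_E^4$ and $\operatorname{rank}\tilde g\le d_E^4$. 2. Let $\varepsilon_1<\tfrac12$.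 For every $(0,\varepsilon_1)$-correct protocol for $f$, $g(x,y)=0\iff f(x,y)=0$ for all $x,y$, and $\log_2 d_E\ge\tfrac14\log_2\operatorname{rank} g$; so if the protocol is optimal, i.e. $\log_2 d_E=C_{0,\varepsilon_1}(f)$, then $C_{0,\varepsilon_1}(f)\ge\tfrac14\log_2\operatorname{rank} g$. Moreover $C_{0,\varepsilon_1}(f)\ge\tfrac14\log_2 r(f)$. 3. Let $\varepsilon_0<\tfrac12$. For every $(\varepsilon_0,0)$-correct protocol for $f$, $\tilde g(x,y)=0\iff\neg f(x,y)=0$ for all $x,y$, and $\log_2 d_E\ge\tfrac14\log_2\operatorname{rank}\tilde g$; so if the protocol is optimal, i.e. $\log_2 d_E=C_{\varepsilon_0,0}(f)$, then $C_{\varepsilon_0,0}(f)\ge\tfrac14\log_2\operatorname{rank}\tilde g$. Moreover $C_{\varepsilon_0,0}(f)\ge\tfrac14\log_2 r(\neg f)$. 4. In particular $FR_0(f)\ge\tfrac14\log_2 r(f)$ and $FR_1(f)\ge\tfrac14\log_2 r(\neg f)$. -/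

import Mathlib

open scoped ComplexOrder MatrixOrder Kronecker

noncomputable section

namespace FRouting

/-- Classical inputs: bit strings of length `n`. -/
abbrev BitString (n : ℕ) : Type := Fin n → Bool

/-- Index set of the computational basis of a qubit. -/
abbrev Qubit : Type := Fin 2

section LinearAlgebra

variable {a b c d : Type}

/-- Partial trace over the first factor. -/
def traceFst [Fintype a] (ρ : Matrix (a × b) (a × b) ℂ) : Matrix b b ℂ :=
  Matrix.of fun i j => ∑ k, ρ (k, i) (k, j)

/-- The map `id_r ⊗ Φ`: apply `Φ` to the second tensor factor. -/
def onSnd (r : Type) (Φ : Matrix a a ℂ →ₗ[ℂ] Matrix b b ℂ) :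
    Matrix (r × a) (r × a) ℂ →ₗ[ℂ] Matrix (r × b) (r × b) ℂ where
  toFun X := Matrix.of fun p q => Φ (Matrix.of fun s t => X (p.1, s) (q.1, t)) p.2 q.2
  map_add' X Y := by
    ext p q
    exact congrFun (congrFun (map_add Φ (Matrix.of fun s t => X (p.1, s) (q.1, t))
      (Matrix.of fun s t => Y (p.1, s) (q.1, t))) p.2) q.2
  map_smul' z X := by
    ext p q
    exact congrFun (congrFun (map_smul Φ z (Matrix.of fun s t => X (p.1, s) (q.1, t))) p.2) q.2

/-- The map `Φ ⊗ id_r`: apply `Φ` to the first tensor factor. -/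
def onFst (r : Type) (Φ : Matrix a a ℂ →ₗ[ℂ] Matrix b b ℂ) :
    Matrix (a × r) (a × r) ℂ →ₗ[ℂ] Matrix (b × r) (b × r) ℂ where
  toFun X := Matrix.of fun p q => Φ (Matrix.of fun s t => X (s, p.2) (t, q.2)) p.1 q.1
  map_add' X Y := by
    ext p q
    exact congrFun (congrFun (map_add Φ (Matrix.of fun s t => X (s, p.2) (t, q.2))
      (Matrix.of fun s t => Y (s, p.2) (t, q.2))) p.1) q.1
  map_smul' z X := by
    ext p q
    exact congrFun (congrFun (map_smul Φ z (Matrix.of fun s t => X (s, p.2) (t, q.2))) p.1) q.1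

/-- The tensor product `Φ ⊗ Ψ` of two linear maps between matrix algebras. -/
def tensorMap (Φ : Matrix a a ℂ →ₗ[ℂ] Matrix b b ℂ) (Ψ : Matrix c c ℂ →ₗ[ℂ] Matrix d d ℂ) :
    Matrix (a × c) (a × c) ℂ →ₗ[ℂ] Matrix (b × d) (b × d) ℂ :=
  (onFst d Φ).comp (onSnd a Ψ)

/-- The rank-one operator `|v⟩⟨v|`. -/
def ketbra (v : a → ℂ) : Matrix a a ℂ := Matrix.vecMulVec v (star v)

/-- The fidelity `F(ρ, σ) = tr √(√σ ρ √σ)` (without a square). -/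
def fidelity [Fintype a] [DecidableEq a] (ρ σ : Matrix a a ℂ) : ℝ :=
  (CFC.sqrt (CFC.sqrt σ * ρ * CFC.sqrt σ)).trace.re

end LinearAlgebra

/-- A quantum channel between finite-dimensional systems: a completely positive
trace-preserving linear map. -/
structure Channel (a b : Type) [Fintype a] [Fintype b] where
  /-- the underlying linear map on operators -/
  map : Matrix a a ℂ →ₗ[ℂ] Matrix b b ℂ
  completelyPositive : ∀ (r : Type) [Fintype r] (X : Matrix (r × a) (r × a) ℂ),
    X.PosSemidef → (onSnd r map X).PosSemidef
  tracePreserving : ∀ X : Matrix a a ℂ, (map X).trace = X.trace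

/-- The maximally entangled two-qubit state `Ψ⁺` on reference `R` and system `Q`. -/
def bellState : Matrix (Qubit × Qubit) (Qubit × Qubit) ℂ :=
  ketbra fun p => if p.1 = p.2 then ((1 / Real.sqrt 2 : ℝ) : ℂ) else 0

/-- A one-round non-local protocol with an input qubit `Q` and classical inputs `x, y` of `n`
bits. Alice holds `L` and Bob holds `E` of a pure resource state on `L ⊗ E`.
On input `x` Alice applies a channel `Q L → M₀ M₀'`, keeps `M₀` and sends `M₀'`; on input `y`
Bob applies a channel `E → M₁ M₁'`, sends `M₁` and keeps `M₁'`. After the exchange Alice holds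
`M = M₀ M₁` and Bob holds `M' = M₀' M₁'`. -/
structure Protocol (n : ℕ) where
  /-- dimension of Alice's part of the resource system -/
  dimL : ℕ
  /-- dimension of Bob's part of the resource system -/
  dimE : ℕ
  /-- dimension of the system kept by Alice -/
  dimM₀ : ℕ
  /-- dimension of the system sent by Alice to Bob -/
  dimM₀' : ℕ
  /-- dimension of the system sent by Bob to Alice -/
  dimM₁ : ℕ
  /-- dimension of the system kept by Bob -/
  dimM₁' : ℕ
  /-- amplitudes of the pure resource state -/
  resource : Fin dimL × Fin dimE → ℂ
  resource_normalized : ∑ p, ‖resource p‖ ^ 2 = 1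
  /-- Alice's first-round channel -/
  alice : BitString n → Channel (Qubit × Fin dimL) (Fin dimM₀ × Fin dimM₀')
  /-- Bob's first-round channel -/
  bob : BitString n → Channel (Fin dimE) (Fin dimM₁ × Fin dimM₁')

namespace Protocol

variable {n : ℕ} (P : Protocol n)

/-- Index set of the system `M = M₀ M₁` held by Alice after the exchange. -/
abbrev SysM : Type := Fin P.dimM₀ × Fin P.dimM₁

/-- Index set of the system `M' = M₀' M₁'` held by Bob after the exchange. -/
abbrev SysM' : Type := Fin P.dimM₀' × Fin P.dimM₁'

/-- The Schmidt rank `d_E` of the resource state: the rank of its coefficient matrix. -/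
def schmidtRank : ℕ :=
  (Matrix.of fun (i : Fin P.dimL) (j : Fin P.dimE) => P.resource (i, j)).rank

/-- The combined first-round action `𝒩^{x,y} : Q → M M'`, namely
`ρ ↦ (𝒩^x ⊗ ℳ^y)(ρ ⊗ |Ψ⟩⟨Ψ|)` with the tensor factors rearranged. -/
def firstRound (x y : BitString n) :
    Matrix Qubit Qubit ℂ →ₗ[ℂ] Matrix (P.SysM × P.SysM') (P.SysM × P.SysM') ℂ :=
  (Matrix.reindexLinearEquiv ℂ ℂ (Equiv.prodProdProdComm _ _ _ _)
      (Equiv.prodProdProdComm _ _ _ _)).toLinearMap ∘ₗ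
    tensorMap (P.alice x).map (P.bob y).map ∘ₗ
    (Matrix.reindexLinearEquiv ℂ ℂ (Equiv.prodAssoc _ _ _).symm
      (Equiv.prodAssoc _ _ _).symm).toLinearMap ∘ₗ
    (Matrix.kroneckerBilinear (R := ℂ) (α := ℂ)).flip (ketbra P.resource)

/-- The mid-protocol state `ρ_{RMM'}` on inputs `x, y`. -/
def midState (x y : BitString n) :
    Matrix (Qubit × (P.SysM × P.SysM')) (Qubit × (P.SysM × P.SysM')) ℂ :=
  onSnd Qubit (P.firstRound x y) bellState

/-- The reduced mid-protocol state `ρ_{RM}`. -/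
def stateRM (x y : BitString n) : Matrix (Qubit × P.SysM) (Qubit × P.SysM) ℂ :=
  Matrix.of fun p q => ∑ k, P.midState x y (p.1, (p.2, k)) (q.1, (q.2, k))

/-- The reduced mid-protocol state `ρ_{RM'}`. -/
def stateRM' (x y : BitString n) : Matrix (Qubit × P.SysM') (Qubit × P.SysM') ℂ :=
  Matrix.of fun p q => ∑ k, P.midState x y (p.1, (k, p.2)) (q.1, (k, q.2))

/-- The protocol completes the `f`-routing task `(ε₀, ε₁)`-correctly on every input: Alice can
recover `Q` from `M` with fidelity at least `1 - ε₀` when `f(x,y) = 0`, and Bob can recover `Q`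
from `M'` with fidelity at least `1 - ε₁` when `f(x,y) = 1`. -/
def IsCorrect (f : BitString n → BitString n → Bool) (ε₀ ε₁ : ℝ) : Prop :=
  ∀ x y : BitString n,
    (f x y = false → ∃ D : Channel P.SysM Qubit,
      1 - ε₀ ≤ fidelity (onSnd Qubit D.map (P.stateRM x y)) bellState) ∧
    (f x y = true → ∃ D : Channel P.SysM' Qubit,
      1 - ε₁ ≤ fidelity (onSnd Qubit D.map (P.stateRM' x y)) bellState)

end Protocol

/-- `tr (ρ_{RS} - I/2 ⊗ ρ_S)²` for an operator on a qubit `R` and a system `S`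
(the trace is real for Hermitian `ρ`). -/
def productDefect {s : Type} [Fintype s] [DecidableEq s]
    (ρ : Matrix (Qubit × s) (Qubit × s) ℂ) : ℝ :=
  ((ρ - ((1 / 2 : ℂ) • (1 : Matrix Qubit Qubit ℂ)) ⊗ₖ traceFst ρ) ^ 2).trace.re

namespace Protocol

variable {n : ℕ} (P : Protocol n)

/-- The structure function `g(x,y) = tr (ρ_{RM'} - I/2 ⊗ ρ_{M'})²`, as a real matrix. -/
def structureFunction : Matrix (BitString n) (BitString n) ℝ :=
  Matrix.of fun x y => productDefect (P.stateRM' x y)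

/-- The structure function with the roles of `M` and `M'` exchanged:
`tr (ρ_{RM} - I/2 ⊗ ρ_M)²`. -/
def structureFunctionSwap : Matrix (BitString n) (BitString n) ℝ :=
  Matrix.of fun x y => productDefect (P.stateRM x y)

end Protocol

variable {n : ℕ}

/-- A real matrix `g` has the zero pattern of the Boolean function `h`:
`g(x,y) = 0` exactly when `h(x,y) = 0`. -/
def HasZeroPattern (g : Matrix (BitString n) (BitString n) ℝ)
    (h : BitString n → BitString n → Bool) : Prop :=
  ∀ x y, g x y = 0 ↔ h x y = false

/-- The smallest rank of a real matrix whose zeros are exactly the zeros of `h`. -/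
def zeroPatternRank (h : BitString n → BitString n → Bool) : ℕ :=
  sInf {r : ℕ | ∃ g : Matrix (BitString n) (BitString n) ℝ, HasZeroPattern g h ∧ g.rank = r}

/-- The entanglement cost of `(ε₀, ε₁)`-correct qubit `f`-routing: the infimum of `log₂` of the
Schmidt rank of the resource state over all `(ε₀, ε₁)`-correct protocols
(`+∞` if there were none). -/
def entanglementCost (f : BitString n → BitString n → Bool) (ε₀ ε₁ : ℝ) : EReal :=
  ⨅ (P : Protocol n) (_ : P.IsCorrect f ε₀ ε₁), ((Real.logb 2 P.schmidtRank : ℝ) : EReal)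

/-- `FR₀(f)`: the cost with `ε₀ = 0`, `ε₁ = 0.05`. -/
def FR₀ (f : BitString n → BitString n → Bool) : EReal := entanglementCost f 0 0.05

/-- `FR₁(f)`: the cost with `ε₀ = 0.05`, `ε₁ = 0`. -/
def FR₁ (f : BitString n → BitString n → Bool) : EReal := entanglementCost f 0.05 0

end FRouting

end

open FRouting

set_option linter.unusedSectionVars false

/-! Rank bound. Factor the coefficient matrix of the resource through dimension d = d_E. The
projector |Ψ⟩⟨Ψ| becomes a sum of d² products of an operator on L and one on E. The channels are
linear and act on separate sides, so the mid-protocol state is Σ_z α_z(x) ⊗ β_z(y) with d² values of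
z (`exists_midState_decomposition`). Since R sits entirely in the α factors, subtracting I/2 ⊗
(marginal) only changes α_z into some γ_z. The trace of the square is then Σ_{z,z'} tr(γ_z γ_z')
tr(β_z β_z'), which factors the structure function through dimension d⁴ (`rank_productDefect_le`).

Zero pattern. The structure function is a squared Hilbert–Schmidt norm, so it vanishes exactly when
R is maximally mixed and in product with the system concerned. Perfect recovery on one side forces
this on the other (`isDecoupled_marginalRight`). Conversely, recovery from a decoupled system
reaches fidelity exactly 1/2 (`fidelity_of_isDecoupled`), which an error below 1/2 excludes. -/

namespace FRouting

/-! ### Rank factorization and extension of scalars -/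

section Rank

variable {K : Type*} [Field K] {m n : Type*} [Fintype m] [Fintype n] [DecidableEq m]
  [DecidableEq n]

/-- Rank factorization, with one-sided inverses of the two factors. -/
lemma exists_rank_factorization (A : Matrix m n K) :
    ∃ (B : Matrix m (Fin A.rank) K) (C : Matrix (Fin A.rank) n K)
      (B' : Matrix (Fin A.rank) m K) (C' : Matrix n (Fin A.rank) K),
      A = B * C ∧ B' * B = 1 ∧ C * C' = 1 := by
  let φ := A.toLin'
  have hr : Module.finrank K (LinearMap.range φ) = A.rank := by
    rw [Matrix.rank_eq_finrank_range_toLin A (Pi.basisFun K m) (Pi.basisFun K n),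
      Matrix.toLin_eq_toLin']
  let e : LinearMap.range φ ≃ₗ[K] (Fin A.rank → K) :=
    (Module.finBasisOfFinrankEq K _ hr).equivFun
  let β : (Fin A.rank → K) →ₗ[K] (m → K) := (LinearMap.range φ).subtype ∘ₗ e.symm.toLinearMap
  let γ : (n → K) →ₗ[K] (Fin A.rank → K) := e.toLinearMap ∘ₗ φ.rangeRestrict
  have hβ : LinearMap.ker β = ⊥ := by
    rw [LinearMap.ker_eq_bot]
    exact (Subtype.val_injective).comp e.symm.injective
  have hγ : LinearMap.range γ = ⊤ := by
    rw [LinearMap.range_eq_top]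
    exact e.surjective.comp φ.surjective_rangeRestrict
  obtain ⟨β', hβ'⟩ := β.exists_leftInverse_of_injective hβ
  obtain ⟨γ', hγ'⟩ := γ.exists_rightInverse_of_surjective hγ
  refine ⟨LinearMap.toMatrix' β, LinearMap.toMatrix' γ, LinearMap.toMatrix' β',
    LinearMap.toMatrix' γ', ?_, ?_, ?_⟩
  · rw [← LinearMap.toMatrix'_comp]
    have : β ∘ₗ γ = φ := by
      ext1 i
      ext1
      simp [β, γ]
    rw [this, LinearMap.toMatrix'_toLin']
  · rw [← LinearMap.toMatrix'_comp, hβ', LinearMap.toMatrix'_id]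
  · rw [← LinearMap.toMatrix'_comp, hγ', LinearMap.toMatrix'_id]

/-- Extending scalars does not decrease the rank of a matrix. -/
lemma rank_le_rank_map {K' : Type*} [Field K'] (φ : K →+* K') (A : Matrix m n K) :
    A.rank ≤ (A.map φ).rank := by
  obtain ⟨B, C, B', C', hA, hB, hC⟩ := exists_rank_factorization A
  -- An identity matrix of size rank A is obtained from A by multiplication; a field homomorphism
  -- preserves this equation.
  have h1 : B' * A * C' = 1 := by
    calc B' * A * C' = B' * (B * C) * C' := by rw [← hA]
      _ = 1 := by rw [← Matrix.mul_assoc, hB, Matrix.one_mul, hC]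
  have h2 : B'.map φ * A.map φ * C'.map φ = 1 := by
    rw [← Matrix.map_mul, ← Matrix.map_mul, h1, Matrix.map_one φ φ.map_zero φ.map_one]
  calc A.rank = (1 : Matrix (Fin A.rank) (Fin A.rank) K').rank := by simp
    _ = (B'.map φ * A.map φ * C'.map φ).rank := by rw [h2]
    _ ≤ (B'.map φ * A.map φ).rank := Matrix.rank_mul_le_left _ _
    _ ≤ (A.map φ).rank := Matrix.rank_mul_le_right _ _

end Rank

/-! ### Kernels of positive semidefinite matrices -/

section Semidefinite

variable {s : Type} [Fintype s] [DecidableEq s]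

/-- For positive A, ⟨v, Av⟩ = 0 forces Av = 0; here v is a basis vector. -/
lemma _root_.Matrix.PosSemidef.col_eq_zero {A : Matrix s s ℂ} (hA : A.PosSemidef) {i : s} (hi : A i i = 0)
    (j : s) : A j i = 0 := by
  have h := (hA.dotProduct_mulVec_zero_iff (Pi.single i 1)).1 (by simp [hi])
  simpa using congrFun h j

lemma dotProduct_single_sub_single (A : Matrix s s ℂ) (i j : s) :
    star (Pi.single i 1 - Pi.single j 1 : s → ℂ) ⬝ᵥ
      (A.mulVec (Pi.single i 1 - Pi.single j 1)) = A i i - A i j - A j i + A j j := by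
  simp [Matrix.mulVec_sub, sub_dotProduct, star_sub]
  ring

/-- The same kernel argument with v = e_i - e_j. -/
lemma _root_.Matrix.PosSemidef.col_eq_col {A : Matrix s s ℂ} (hA : A.PosSemidef) {i j : s}
    (hij : A i i - A i j - A j i + A j j = 0) (k : s) : A k i = A k j := by
  have h := (hA.dotProduct_mulVec_zero_iff (Pi.single i 1 - Pi.single j 1)).1
    (by rw [dotProduct_single_sub_single, hij])
  have := congrFun h k
  simpa [Matrix.mulVec_sub, sub_eq_zero] using this

/-- Y² = Y†Y has as trace the sum of the squared moduli of the entries, so taking the real part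
loses nothing. -/
lemma trace_sq_re_eq_zero_iff {Y : Matrix s s ℂ} (hY : Y.IsHermitian) :
    (Y ^ 2).trace.re = 0 ↔ Y = 0 := by
  have h : Y ^ 2 = Y.conjTranspose * Y := by rw [hY.eq, sq]
  have h0 : 0 ≤ (Y ^ 2).trace := by
    rw [h]; exact (Matrix.posSemidef_conjTranspose_mul_self Y).trace_nonneg
  rw [← Matrix.trace_conjTranspose_mul_self_eq_zero_iff, ← h, Complex.ext_iff]
  exact ⟨fun h => ⟨h, (Complex.le_def.1 h0).2.symm⟩, fun h => h.1⟩

lemma ofReal_trace_sq_re {Y : Matrix s s ℂ} (hY : Y.IsHermitian) :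
    (((Y ^ 2).trace.re : ℝ) : ℂ) = (Y ^ 2).trace := by
  have h : Y ^ 2 = Y.conjTranspose * Y := by rw [hY.eq, sq]
  have h0 : 0 ≤ (Y ^ 2).trace := by
    rw [h]; exact (Matrix.posSemidef_conjTranspose_mul_self Y).trace_nonneg
  exact Complex.ext (by simp) (by simpa using (Complex.le_def.1 h0).2)

end Semidefinite

/-! ### Fidelity with the Bell state -/

section Bell

/-- The expectation value `⟨Ψ⁺|σ|Ψ⁺⟩`. -/
noncomputable def bellOverlap (σ : Matrix (Qubit × Qubit) (Qubit × Qubit) ℂ) : ℂ :=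
  (σ (0, 0) (0, 0) + σ (0, 0) (1, 1) + σ (1, 1) (0, 0) + σ (1, 1) (1, 1)) / 2

lemma bellState_apply (p q : Qubit × Qubit) :
    bellState p q = if p.1 = p.2 ∧ q.1 = q.2 then 1 / 2 else 0 := by
  have h : ((Real.sqrt 2 : ℝ) : ℂ)⁻¹ * ((Real.sqrt 2 : ℝ) : ℂ)⁻¹ = 2⁻¹ := by
    rw [← mul_inv, ← Complex.ofReal_mul, Real.mul_self_sqrt (by norm_num)]; simp
  simp only [bellState, ketbra, Matrix.vecMulVec_apply, Pi.star_apply]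
  by_cases h1 : p.1 = p.2 <;> by_cases h2 : q.1 = q.2 <;> simp [h1, h2, h]

lemma posSemidef_ketbra {a : Type} [Fintype a] (v : a → ℂ) : (ketbra v).PosSemidef :=
  Matrix.posSemidef_vecMulVec_self_star v

lemma posSemidef_bellState : bellState.PosSemidef := posSemidef_ketbra _

lemma trace_bellState : bellState.trace = 1 := by
  simp [Matrix.trace, Fintype.sum_prod_type, bellState_apply]

lemma bellState_mul_mul (σ : Matrix (Qubit × Qubit) (Qubit × Qubit) ℂ) :
    bellState * σ * bellState = bellOverlap σ • bellState := by
  ext ⟨a, b⟩ ⟨c, d⟩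
  fin_cases a <;> fin_cases b <;> fin_cases c <;> fin_cases d <;>
    simp [Matrix.mul_apply, Fintype.sum_prod_type, bellState_apply, bellOverlap] <;> ring

lemma bellState_mul_self : bellState * bellState = bellState := by
  have := bellState_mul_mul 1
  rw [mul_one] at this
  rw [this]
  simp [bellOverlap]

/-- The Bell state is a rank-one projection: it is its own square root, and sandwiching σ by it
gives a nonnegative multiple of it. -/
lemma fidelity_bellState {σ : Matrix (Qubit × Qubit) (Qubit × Qubit) ℂ} (hσ : σ.PosSemidef) :
    fidelity σ bellState = Real.sqrt (bellOverlap σ).re := by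
  have hb : (0 : Matrix (Qubit × Qubit) (Qubit × Qubit) ℂ) ≤ bellState :=
    Matrix.nonneg_iff_posSemidef.2 posSemidef_bellState
  have h1 : CFC.sqrt bellState = bellState := CFC.sqrt_unique bellState_mul_self hb
  have h0 : 0 ≤ bellOverlap σ := by
    have h2 := hσ.conjTranspose_mul_mul_same bellState
    rw [posSemidef_bellState.1.eq, bellState_mul_mul] at h2
    have h3 := h2.trace_nonneg
    rwa [Matrix.trace_smul, trace_bellState, smul_eq_mul, mul_one] at h3
  obtain ⟨hre, him⟩ := Complex.le_def.1 h0
  have h2 : CFC.sqrt (bellOverlap σ • bellState) =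
      ((Real.sqrt (bellOverlap σ).re : ℝ) : ℂ) • bellState := by
    refine CFC.sqrt_unique ?_ ?_
    · rw [smul_mul_smul_comm, bellState_mul_self, ← Complex.ofReal_mul, Real.mul_self_sqrt hre]
      congr 1
      exact Complex.ext (by simp) (by simpa using him)
    · exact Matrix.nonneg_iff_posSemidef.2 (posSemidef_bellState.smul (by
        simp [Real.sqrt_nonneg]))
  rw [fidelity, h1, bellState_mul_mul, h2, Matrix.trace_smul, trace_bellState]
  simp

/-- A unit-trace positive operator with full Bell overlap has no weight orthogonal to `Ψ⁺`. -/
lemma support_of_one_le_fidelity {σ : Matrix (Qubit × Qubit) (Qubit × Qubit) ℂ}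
    (hσ : σ.PosSemidef) (htr : σ.trace = 1) (hF : 1 ≤ fidelity σ bellState) :
    σ (0, 1) (0, 1) = 0 ∧ σ (1, 0) (1, 0) = 0 ∧
      σ (0, 0) (0, 0) - σ (0, 0) (1, 1) - σ (1, 1) (0, 0) + σ (1, 1) (1, 1) = 0 := by
  rw [fidelity_bellState hσ, Real.one_le_sqrt] at hF
  have h1 : 0 ≤ σ (0, 1) (0, 1) := hσ.diag_nonneg
  have h2 : 0 ≤ σ (1, 0) (1, 0) := hσ.diag_nonneg
  have h3 := hσ.dotProduct_mulVec_nonneg (Pi.single (0, 0) 1 - Pi.single (1, 1) 1)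
  rw [dotProduct_single_sub_single] at h3
  have h4 : (bellOverlap σ).re = ((σ (0, 0) (0, 0)).re + (σ (0, 0) (1, 1)).re +
      (σ (1, 1) (0, 0)).re + (σ (1, 1) (1, 1)).re) / 2 := by
    rw [bellOverlap, Complex.div_ofNat_re]; simp
  simp only [Matrix.trace, Matrix.diag, Fintype.sum_prod_type, Fin.sum_univ_two] at htr
  have h5 := congrArg Complex.re htr
  simp only [Complex.add_re, Complex.one_re] at h5
  obtain ⟨h1r, h1i⟩ := Complex.le_def.1 h1
  obtain ⟨h2r, h2i⟩ := Complex.le_def.1 h2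
  obtain ⟨h3r, h3i⟩ := Complex.le_def.1 h3
  simp only [Complex.add_re, Complex.sub_re, Complex.zero_re] at h1r h2r h3r
  -- The trace is the overlap plus the first two quantities plus half the third. All three are
  -- nonnegative, and the overlap already reaches 1.
  refine ⟨Complex.ext ?_ h1i.symm, Complex.ext ?_ h2i.symm, Complex.ext ?_ h3i.symm⟩ <;>
    simp only [Complex.add_re, Complex.sub_re, Complex.zero_re] <;> linarith

end Bell

/-! ### Marginals and exchange of subsystems -/

section Bipartite

variable {r a b : Type} [Fintype r] [Fintype a] [Fintype b]

/-- The marginal on `R A` of an operator on `R ⊗ (A ⊗ B)`. -/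
def marginalLeft (ω : Matrix (r × (a × b)) (r × (a × b)) ℂ) : Matrix (r × a) (r × a) ℂ :=
  Matrix.of fun p q => ∑ k, ω (p.1, (p.2, k)) (q.1, (q.2, k))

/-- The marginal on `R B` of an operator on `R ⊗ (A ⊗ B)`. -/
def marginalRight (ω : Matrix (r × (a × b)) (r × (a × b)) ℂ) : Matrix (r × b) (r × b) ℂ :=
  Matrix.of fun p q => ∑ k, ω (p.1, (k, p.2)) (q.1, (k, q.2))

/-- Exchange the two subsystems of an operator on `R ⊗ (A ⊗ B)`. -/
def swapSnd (ω : Matrix (r × (a × b)) (r × (a × b)) ℂ) : Matrix (r × (b × a)) (r × (b × a)) ℂ :=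
  ω.submatrix (Prod.map id Prod.swap) (Prod.map id Prod.swap)

lemma marginalLeft_posSemidef {ω : Matrix (r × (a × b)) (r × (a × b)) ℂ} (hω : ω.PosSemidef) :
    (marginalLeft ω).PosSemidef := by
  have : marginalLeft ω =
      ∑ k, ω.submatrix (fun p => (p.1, (p.2, k))) (fun p => (p.1, (p.2, k))) := by
    ext p q
    simp [marginalLeft, Matrix.sum_apply]
  rw [this]
  exact Matrix.posSemidef_sum _ fun k _ => hω.submatrix _

lemma swapSnd_posSemidef {ω : Matrix (r × (a × b)) (r × (a × b)) ℂ} (hω : ω.PosSemidef) :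
    (swapSnd ω).PosSemidef := hω.submatrix _

lemma marginalLeft_swapSnd (ω : Matrix (r × (a × b)) (r × (a × b)) ℂ) :
    marginalLeft (swapSnd ω) = marginalRight ω := rfl

lemma trace_swapSnd (ω : Matrix (r × (a × b)) (r × (a × b)) ℂ) :
    (swapSnd ω).trace = ω.trace := by
  simp only [Matrix.trace, swapSnd, Matrix.diag, Matrix.submatrix_apply, Fintype.sum_prod_type]
  exact Finset.sum_congr rfl fun _ _ => Finset.sum_comm

lemma marginalRight_posSemidef {ω : Matrix (r × (a × b)) (r × (a × b)) ℂ} (hω : ω.PosSemidef) :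
    (marginalRight ω).PosSemidef := by
  rw [← marginalLeft_swapSnd]
  exact marginalLeft_posSemidef (swapSnd_posSemidef hω)

lemma trace_marginalLeft (ω : Matrix (r × (a × b)) (r × (a × b)) ℂ) :
    (marginalLeft ω).trace = ω.trace := by
  simp [Matrix.trace, marginalLeft, Fintype.sum_prod_type]

lemma trace_marginalRight (ω : Matrix (r × (a × b)) (r × (a × b)) ℂ) :
    (marginalRight ω).trace = ω.trace := by
  rw [← marginalLeft_swapSnd, trace_marginalLeft, trace_swapSnd]

lemma trace_onSnd (D : Channel a b) (X : Matrix (r × a) (r × a) ℂ) :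
    (onSnd r D.map X).trace = X.trace := by
  have h (i : r) := D.tracePreserving (Matrix.of fun s t => X (i, s) (i, t))
  simp only [Matrix.trace, Matrix.diag, Matrix.of_apply] at h
  simp only [Matrix.trace, Matrix.diag, Fintype.sum_prod_type, onSnd, LinearMap.coe_mk,
    AddHom.coe_mk, Matrix.of_apply]
  exact Finset.sum_congr rfl fun i _ => h i

end Bipartite

/-! ### Perfect recovery versus decoupling -/

section Decoupling

variable {a b s : Type} [Fintype a] [Fintype b] [Fintype s] [DecidableEq s]

/-- An operator on `R ⊗ S` of the form `I/2 ⊗ σ`. -/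
def IsDecoupled (ρ : Matrix (Qubit × s) (Qubit × s) ℂ) : Prop :=
  ρ = ((1 / 2 : ℂ) • (1 : Matrix Qubit Qubit ℂ)) ⊗ₖ traceFst ρ

lemma isHermitian_sub_product {ρ : Matrix (Qubit × s) (Qubit × s) ℂ} (hρ : ρ.IsHermitian) :
    (ρ - ((1 / 2 : ℂ) • (1 : Matrix Qubit Qubit ℂ)) ⊗ₖ traceFst ρ).IsHermitian := by
  refine hρ.sub ?_
  ext ⟨i, k⟩ ⟨j, l⟩
  have h (i : Qubit) : star (ρ (i, l) (i, k)) = ρ (i, k) (i, l) := hρ.apply _ _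
  simp only [Complex.star_def] at h
  by_cases hij : i = j
  · simp [hij, traceFst, h]
  · simp [hij, Ne.symm hij]

lemma productDefect_eq_zero_iff {ρ : Matrix (Qubit × s) (Qubit × s) ℂ} (hρ : ρ.IsHermitian) :
    productDefect ρ = 0 ↔ IsDecoupled ρ := by
  rw [productDefect, trace_sq_re_eq_zero_iff (isHermitian_sub_product hρ), sub_eq_zero]
  rfl

/-- If `Q` can be recovered perfectly from `A`, then the reference is decoupled from `B`. -/
lemma isDecoupled_marginalRight {ω : Matrix (Qubit × (a × s)) (Qubit × (a × s)) ℂ}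
    (hω : ω.PosSemidef) (htr : ω.trace = 1) (D : Channel a Qubit)
    (hD : 1 ≤ fidelity (onSnd Qubit D.map (marginalLeft ω)) bellState) :
    IsDecoupled (marginalRight ω) := by
  -- S joins R as part of the reference, so that D acts on A alone and complete positivity makes τ,
  -- on R S Q, positive.
  let e : (Qubit × s) × a → Qubit × (a × s) := fun p => (p.1.1, (p.2, p.1.2))
  let τ := onSnd (Qubit × s) D.map (ω.submatrix e e)
  have hτ : τ.PosSemidef := D.completelyPositive _ _ (hω.submatrix e)
  have hσ : (onSnd Qubit D.map (marginalLeft ω)).PosSemidef :=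
    D.completelyPositive _ _ (marginalLeft_posSemidef hω)
  have hmarg (i j q q' : Qubit) :
      onSnd Qubit D.map (marginalLeft ω) (i, q) (j, q') = ∑ k, τ ((i, k), q) ((j, k), q') := by
    have : (Matrix.of fun s t => marginalLeft ω (i, s) (j, t)) =
        ∑ k, Matrix.of fun s t => ω.submatrix e e ((i, k), s) ((j, k), t) := by
      ext s t
      simp [marginalLeft, Matrix.sum_apply, e]
    simp only [onSnd, τ, LinearMap.coe_mk, AddHom.coe_mk, Matrix.of_apply]
    rw [this, map_sum, Matrix.sum_apply]
  have htrace (i j : Qubit) (k l : s) :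
      marginalRight ω (i, k) (j, l) = ∑ q, τ ((i, k), q) ((j, l), q) :=
    (D.tracePreserving (Matrix.of fun s t => ω.submatrix e e ((i, k), s) ((j, l), t))).symm
  obtain ⟨h01, h10, hd⟩ := support_of_one_le_fidelity hσ
    (by rw [trace_onSnd, trace_marginalLeft, htr]) hD
  simp only [hmarg] at h01 h10 hd
  -- The weights outside Ψ⁺ are sums over S of nonnegative terms, so they vanish for each k. Hence τ
  -- is supported on Ψ⁺ ⊗ S, that is, τ = Ψ⁺ ⊗ σ.
  rw [Finset.sum_eq_zero_iff_of_nonneg fun _ _ => hτ.diag_nonneg] at h01 h10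
  rw [← Finset.sum_sub_distrib, ← Finset.sum_sub_distrib, ← Finset.sum_add_distrib,
    Finset.sum_eq_zero_iff_of_nonneg fun k _ => by
      rw [← dotProduct_single_sub_single]; exact hτ.dotProduct_mulVec_nonneg _] at hd
  have c01 (k : s) (p) : τ p ((0, k), 1) = 0 := hτ.col_eq_zero (h01 k (Finset.mem_univ k)) p
  have c10 (k : s) (p) : τ p ((1, k), 0) = 0 := hτ.col_eq_zero (h10 k (Finset.mem_univ k)) p
  have cd (k : s) (p) : τ p ((0, k), 0) = τ p ((1, k), 1) :=
    hτ.col_eq_col (hd k (Finset.mem_univ k)) p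
  have r01 (k : s) (p) : τ ((0, k), 1) p = 0 := by rw [← hτ.1.apply, c01, star_zero]
  have r10 (k : s) (p) : τ ((1, k), 0) p = 0 := by rw [← hτ.1.apply, c10, star_zero]
  have rd (k : s) (p) : τ ((0, k), 0) p = τ ((1, k), 1) p := by
    rw [← hτ.1.apply, cd, hτ.1.apply]
  ext ⟨i, k⟩ ⟨j, l⟩
  simp only [Matrix.kroneckerMap_apply, Matrix.smul_apply, traceFst, Matrix.of_apply, htrace,
    Fin.sum_univ_two]
  fin_cases i <;> fin_cases j <;> simp [c01, c10, r01, r10, cd, rd] <;> ring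

/-- If the reference is decoupled from `S`, recovery from `S` has fidelity one half. -/
lemma fidelity_of_isDecoupled {ρ : Matrix (Qubit × s) (Qubit × s) ℂ} (hρ : ρ.PosSemidef)
    (htr : ρ.trace = 1) (h : IsDecoupled ρ) (D : Channel s Qubit) :
    fidelity (onSnd Qubit D.map ρ) bellState = 1 / 2 := by
  have hσ : (onSnd Qubit D.map ρ).PosSemidef := D.completelyPositive _ _ hρ
  have h1 (i j : Qubit) : (Matrix.of fun s t => ρ (i, s) (j, t)) =
      (if i = j then (1 / 2 : ℂ) else 0) • traceFst ρ := by
    ext s t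
    have := congrFun (congrFun h (i, s)) (j, t)
    rw [Matrix.of_apply, this]
    simp [Matrix.one_apply]
  have htr2 : (traceFst ρ).trace = 1 := by
    rw [← htr]
    simp only [Matrix.trace, traceFst, Matrix.diag, Matrix.of_apply, Fintype.sum_prod_type]
    exact Finset.sum_comm
  have h2 := D.tracePreserving (traceFst ρ)
  rw [htr2] at h2
  simp only [Matrix.trace, Matrix.diag, Fin.sum_univ_two] at h2
  -- The output is I/2 ⊗ D(ρ_S): the off-diagonal terms vanish and the overlap is tr D(ρ_S) / 4.
  have h3 : bellOverlap (onSnd Qubit D.map ρ) = 1 / 4 := by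
    simp only [bellOverlap, onSnd, LinearMap.coe_mk, AddHom.coe_mk, Matrix.of_apply, h1, map_smul,
      Matrix.smul_apply, smul_eq_mul]
    simp
    linear_combination (1 / 4 : ℂ) * h2
  rw [fidelity_bellState hσ, h3, show ((1 / 4 : ℂ)).re = (1 / 2) ^ 2 by norm_num,
    Real.sqrt_sq (by norm_num)]

end Decoupling

/-! ### Rank of the defect matrix -/

section StructureFunction

variable {s t ι X Y : Type} [Fintype s] [Fintype t] [DecidableEq s] [DecidableEq t] [Fintype ι]
  [Fintype X] [Fintype Y] [DecidableEq X] [DecidableEq Y]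

/-- The defect matrix of a family of Hermitian operators that are sums of `|ι|` products of an
`x`-dependent and a `y`-dependent factor has rank at most `|ι| ^ 2`. -/
lemma rank_productDefect_le (ρ : X → Y → Matrix (Qubit × (s × t)) (Qubit × (s × t)) ℂ)
    (hρ : ∀ x y, (ρ x y).IsHermitian)
    (α : ι → X → Matrix (Qubit × s) (Qubit × s) ℂ) (β : ι → Y → Matrix t t ℂ)
    (h : ∀ x y i k l j k' l', ρ x y (i, (k, l)) (j, (k', l')) =
      ∑ z, α z x (i, k) (j, k') * β z y l l') :
    (Matrix.of fun x y => productDefect (ρ x y)).rank ≤ Fintype.card ι ^ 2 := by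
  let γ (z : ι) (x : X) : Matrix (Qubit × s) (Qubit × s) ℂ :=
    α z x - ((1 / 2 : ℂ) • (1 : Matrix Qubit Qubit ℂ)) ⊗ₖ traceFst (α z x)
  have hγ (x y i k l j k' l') :
      (ρ x y - ((1 / 2 : ℂ) • (1 : Matrix Qubit Qubit ℂ)) ⊗ₖ traceFst (ρ x y))
        (i, (k, l)) (j, (k', l')) = ∑ z, γ z x (i, k) (j, k') * β z y l l' := by
    simp only [γ, Matrix.sub_apply, Matrix.kroneckerMap_apply, traceFst, Matrix.of_apply, h,
      Fin.sum_univ_two, sub_mul, Finset.sum_sub_distrib, ← Finset.sum_add_distrib,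
      Finset.mul_sum]
    congr 1
    exact Finset.sum_congr rfl fun _ _ => by ring
  -- These factors are complex although the defect is real, hence the passage to ℂ through
  -- `rank_le_rank_map`.
  let U : Matrix X (ι × ι) ℂ := Matrix.of fun x z => (γ z.1 x * γ z.2 x).trace
  let V : Matrix (ι × ι) Y ℂ := Matrix.of fun z y => (β z.1 y * β z.2 y).trace
  have hUV : (Matrix.of fun x y => productDefect (ρ x y)).map Complex.ofRealHom = U * V := by
    ext x y
    rw [Matrix.map_apply, Matrix.of_apply, Complex.ofRealHom_eq_coe, productDefect,
      ofReal_trace_sq_re (isHermitian_sub_product (hρ x y)), sq, Matrix.mul_apply]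
    simp only [Matrix.trace, Matrix.diag, Matrix.mul_apply, U, V, Matrix.of_apply]
    have : ∀ p q : Qubit × (s × t),
        (ρ x y - ((1 / 2 : ℂ) • (1 : Matrix Qubit Qubit ℂ)) ⊗ₖ traceFst (ρ x y)) p q *
        (ρ x y - ((1 / 2 : ℂ) • (1 : Matrix Qubit Qubit ℂ)) ⊗ₖ traceFst (ρ x y)) q p =
        ∑ z : ι × ι, (γ z.1 x (p.1, p.2.1) (q.1, q.2.1) * γ z.2 x (q.1, q.2.1) (p.1, p.2.1)) *
          (β z.1 y p.2.2 q.2.2 * β z.2 y q.2.2 p.2.2) := by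
      rintro ⟨i, k, l⟩ ⟨j, k', l'⟩
      rw [hγ, hγ, Finset.sum_mul_sum, Fintype.sum_prod_type]
      exact Finset.sum_congr rfl fun _ _ => Finset.sum_congr rfl fun _ _ => by ring
    simp only [this]
    calc _ = ∑ p : Qubit × (s × t), ∑ z : ι × ι, ∑ q : Qubit × (s × t),
          (γ z.1 x (p.1, p.2.1) (q.1, q.2.1) * γ z.2 x (q.1, q.2.1) (p.1, p.2.1)) *
          (β z.1 y p.2.2 q.2.2 * β z.2 y q.2.2 p.2.2) :=
          Finset.sum_congr rfl fun _ _ => Finset.sum_comm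
      _ = _ := by
        rw [Finset.sum_comm]
        refine Finset.sum_congr rfl fun z _ => ?_
        rw [Finset.sum_mul_sum]
        simp only [Finset.sum_mul_sum]
        rw [← (Equiv.prodAssoc Qubit s t).sum_comp, Fintype.sum_prod_type]
        refine Finset.sum_congr rfl fun _ _ => Finset.sum_congr rfl fun _ _ => ?_
        rw [← (Equiv.prodAssoc Qubit s t).sum_comp, Fintype.sum_prod_type]
        rfl
  calc _ ≤ ((Matrix.of fun x y => productDefect (ρ x y)).map Complex.ofRealHom).rank :=
        rank_le_rank_map _ _
    _ = (U * V).rank := by rw [hUV]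
    _ ≤ U.rank := Matrix.rank_mul_le_left _ _
    _ ≤ Fintype.card (ι × ι) := Matrix.rank_le_card_width _
    _ = _ := by rw [Fintype.card_prod, sq]

end StructureFunction

/-! ### The mid-protocol state and its structure functions -/

namespace Protocol

variable {n : ℕ} (P : Protocol n)

lemma midState_apply (x y : BitString n) (i j : Qubit) (k k' : Fin P.dimM₀)
    (l l' : Fin P.dimM₁) (u u' : Fin P.dimM₀') (v v' : Fin P.dimM₁') :
    P.midState x y (i, ((k, l), (u, v))) (j, ((k', l'), (u', v'))) =
      (P.alice x).map (Matrix.of fun s t => (P.bob y).map (Matrix.of fun e e' =>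
        bellState (i, s.1) (j, t.1) * ketbra P.resource (s.2, e) (t.2, e')) (l, v) (l', v'))
        (k, u) (k', u') := rfl

/-- The joint state before the first round, with Bob's system last. -/
noncomputable def initialState : Matrix ((Qubit × (Qubit × Fin P.dimL)) × Fin P.dimE)
    ((Qubit × (Qubit × Fin P.dimL)) × Fin P.dimE) ℂ :=
  (bellState ⊗ₖ ketbra P.resource).submatrix
    (fun p => ((p.1.1, p.1.2.1), (p.1.2.2, p.2))) (fun p => ((p.1.1, p.1.2.1), (p.1.2.2, p.2)))

lemma initialState_posSemidef : P.initialState.PosSemidef :=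
  (posSemidef_bellState.kronecker (posSemidef_ketbra _)).submatrix _

lemma trace_ketbra_resource : (ketbra P.resource).trace = 1 := by
  have h := congrArg (fun z : ℝ => (z : ℂ)) P.resource_normalized
  simp only [Complex.ofReal_sum, Complex.ofReal_one] at h
  rw [← h]
  refine Finset.sum_congr rfl fun p _ => ?_
  simp [ketbra, Matrix.vecMulVec_apply, Complex.mul_conj, Complex.normSq_eq_norm_sq]

lemma trace_initialState : P.initialState.trace = 1 := by
  have h : P.initialState.trace = (bellState ⊗ₖ ketbra P.resource).trace := by
    simp only [initialState, Matrix.trace, Matrix.diag, Matrix.submatrix_apply,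
      Fintype.sum_prod_type]
  rw [h, Matrix.trace_kronecker, trace_bellState, P.trace_ketbra_resource, mul_one]

/-- The joint state after Bob's operation, with Alice's systems last. -/
noncomputable def stateAfterBob (y : BitString n) :
    Matrix ((Qubit × (Fin P.dimM₁ × Fin P.dimM₁')) × (Qubit × Fin P.dimL))
      ((Qubit × (Fin P.dimM₁ × Fin P.dimM₁')) × (Qubit × Fin P.dimL)) ℂ :=
  (onSnd _ (P.bob y).map P.initialState).submatrix
    (fun p => ((p.1.1, p.2), p.1.2)) (fun p => ((p.1.1, p.2), p.1.2))

/-- The joint state after both operations. -/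
noncomputable def stateAfterBoth (x y : BitString n) :
    Matrix ((Qubit × (Fin P.dimM₁ × Fin P.dimM₁')) × (Fin P.dimM₀ × Fin P.dimM₀'))
      ((Qubit × (Fin P.dimM₁ × Fin P.dimM₁')) × (Fin P.dimM₀ × Fin P.dimM₀')) ℂ :=
  onSnd _ (P.alice x).map (P.stateAfterBob y)

/-- Writes the parallel channels as two successive ones, each with all other systems as its
reference, so that complete positivity and trace preservation apply. -/
lemma midState_eq (x y : BitString n) :
    P.midState x y = (P.stateAfterBoth x y).submatrix
      (fun p => ((p.1, (p.2.1.2, p.2.2.2)), (p.2.1.1, p.2.2.1)))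
      (fun p => ((p.1, (p.2.1.2, p.2.2.2)), (p.2.1.1, p.2.2.1))) := rfl

lemma midState_posSemidef (x y : BitString n) : (P.midState x y).PosSemidef := by
  rw [midState_eq]
  refine Matrix.PosSemidef.submatrix ((P.alice x).completelyPositive _ _ ?_) _
  exact ((P.bob y).completelyPositive _ _ P.initialState_posSemidef).submatrix _

lemma trace_midState (x y : BitString n) : (P.midState x y).trace = 1 := by
  have h1 : (P.midState x y).trace = (P.stateAfterBoth x y).trace := by
    let e : Qubit × (P.SysM × P.SysM') ≃
        (Qubit × (Fin P.dimM₁ × Fin P.dimM₁')) × (Fin P.dimM₀ × Fin P.dimM₀') :=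
      { toFun := fun p => ((p.1, (p.2.1.2, p.2.2.2)), (p.2.1.1, p.2.2.1))
        invFun := fun p => (p.1.1, ((p.2.1, p.1.2.1), (p.2.2, p.1.2.2)))
        left_inv := fun _ => rfl
        right_inv := fun _ => rfl }
    rw [midState_eq]
    exact e.sum_comp fun p => P.stateAfterBoth x y p p
  have h2 : (P.stateAfterBob y).trace = (onSnd _ (P.bob y).map P.initialState).trace := by
    let e : (Qubit × (Fin P.dimM₁ × Fin P.dimM₁')) × (Qubit × Fin P.dimL) ≃
        (Qubit × (Qubit × Fin P.dimL)) × (Fin P.dimM₁ × Fin P.dimM₁') :=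
      { toFun := fun p => ((p.1.1, p.2), p.1.2)
        invFun := fun p => ((p.1.1, p.2), p.1.2)
        left_inv := fun _ => rfl
        right_inv := fun _ => rfl }
    exact e.sum_comp fun p => onSnd _ (P.bob y).map P.initialState p p
  rw [h1, stateAfterBoth, trace_onSnd, h2, trace_onSnd, P.trace_initialState]

lemma stateRM_posSemidef (x y : BitString n) : (P.stateRM x y).PosSemidef :=
  marginalLeft_posSemidef (P.midState_posSemidef x y)

lemma stateRM'_posSemidef (x y : BitString n) : (P.stateRM' x y).PosSemidef :=
  marginalRight_posSemidef (P.midState_posSemidef x y)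

lemma trace_stateRM (x y : BitString n) : (P.stateRM x y).trace = 1 :=
  (trace_marginalLeft _).trans (P.trace_midState x y)

lemma trace_stateRM' (x y : BitString n) : (P.stateRM' x y).trace = 1 :=
  (trace_marginalRight _).trans (P.trace_midState x y)

/-- The mid-protocol state is a sum of `d_E ^ 2` products of an operator on `R M₀ M₀'` depending
only on `x` and an operator on `M₁ M₁'` depending only on `y`. -/
lemma exists_midState_decomposition :
    ∃ (α : Fin P.schmidtRank × Fin P.schmidtRank → BitString n →
        Matrix (Qubit × (Fin P.dimM₀ × Fin P.dimM₀')) (Qubit × (Fin P.dimM₀ × Fin P.dimM₀')) ℂ)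
      (β : Fin P.schmidtRank × Fin P.schmidtRank → BitString n →
        Matrix (Fin P.dimM₁ × Fin P.dimM₁') (Fin P.dimM₁ × Fin P.dimM₁') ℂ),
      ∀ x y i j k k' l l' u u' v v',
        P.midState x y (i, ((k, l), (u, v))) (j, ((k', l'), (u', v'))) =
          ∑ z, α z x (i, (k, u)) (j, (k', u')) * β z y (l, v) (l', v') := by
  obtain ⟨B, C, -, -, hBC, -, -⟩ := exists_rank_factorization
    (Matrix.of fun (i : Fin P.dimL) (j : Fin P.dimE) => P.resource (i, j))
  change Matrix (Fin P.dimL) (Fin P.schmidtRank) ℂ at B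
  change Matrix (Fin P.schmidtRank) (Fin P.dimE) ℂ at C
  have hres (l : Fin P.dimL) (e : Fin P.dimE) : P.resource (l, e) = ∑ z, B l z * C z e :=
    congrFun (congrFun hBC l) e
  -- z.1 labels the term of the ket and z.2 that of the bra, whence d² products; the Bell entry goes
  -- to Alice's factor.
  let A (z : Fin P.schmidtRank × Fin P.schmidtRank) (i j : Qubit) :
      Matrix (Qubit × Fin P.dimL) (Qubit × Fin P.dimL) ℂ := Matrix.of fun s t =>
    bellState (i, s.1) (j, t.1) * (B s.2 z.1 * star (B t.2 z.2))
  let T (z : Fin P.schmidtRank × Fin P.schmidtRank) : Matrix (Fin P.dimE) (Fin P.dimE) ℂ :=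
    Matrix.of fun e e' => C z.1 e * star (C z.2 e')
  have hket (l l' : Fin P.dimL) (e e' : Fin P.dimE) : ketbra P.resource (l, e) (l', e') =
      ∑ z : Fin P.schmidtRank × Fin P.schmidtRank,
        (B l z.1 * star (B l' z.2)) * T z e e' := by
    simp only [ketbra, Matrix.vecMulVec_apply, Pi.star_apply, hres, star_sum, star_mul']
    rw [Finset.sum_mul_sum, Fintype.sum_prod_type]
    exact Finset.sum_congr rfl fun _ _ => Finset.sum_congr rfl fun _ _ => by
      simp only [T, Matrix.of_apply]; ring
  refine ⟨fun z x => Matrix.of fun p q => (P.alice x).map (A z p.1 q.1) p.2 q.2,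
    fun z y => (P.bob y).map (T z), fun x y i j k k' l l' u u' v v' => ?_⟩
  have hbob (s t : Qubit × Fin P.dimL) : (Matrix.of fun e e' =>
      bellState (i, s.1) (j, t.1) * ketbra P.resource (s.2, e) (t.2, e')) =
      ∑ z, A z i j s t • T z := by
    ext e e'
    simp only [Matrix.of_apply, hket, Finset.mul_sum, Matrix.sum_apply, Matrix.smul_apply, A,
      smul_eq_mul, mul_assoc]
  have halice : (Matrix.of fun s t => (P.bob y).map (Matrix.of fun e e' =>
        bellState (i, s.1) (j, t.1) * ketbra P.resource (s.2, e) (t.2, e')) (l, v) (l', v')) =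
      ∑ z, (P.bob y).map (T z) (l, v) (l', v') • A z i j := by
    ext s t
    rw [Matrix.of_apply, hbob, map_sum, Matrix.sum_apply, Matrix.sum_apply]
    simp only [map_smul, Matrix.smul_apply, smul_eq_mul, mul_comm]
  rw [midState_apply, halice, map_sum, Matrix.sum_apply]
  simp only [map_smul, Matrix.smul_apply, smul_eq_mul, Matrix.of_apply, mul_comm]

lemma rank_structureFunction_le : P.structureFunction.rank ≤ P.schmidtRank ^ 4 := by
  obtain ⟨α, β, h⟩ := P.exists_midState_decomposition
  have := rank_productDefect_le P.stateRM' (fun x y => (P.stateRM'_posSemidef x y).1)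
    -- Tracing out M = M₀M₁ splits into M₀ on Alice's factor and M₁ on Bob's.
    (fun z x => marginalRight (α z x)) (fun z y => traceFst (β z y)) (by
      intro x y i u v j u' v'
      simp only [stateRM', marginalRight, traceFst, Matrix.of_apply, Fintype.sum_prod_type
        (α₁ := Fin P.dimM₀), h, Finset.sum_mul_sum]
      rw [Finset.sum_congr rfl fun _ _ => Finset.sum_comm, Finset.sum_comm])
  calc _ ≤ _ := this
    _ = _ := by rw [Fintype.card_prod, Fintype.card_fin]; ring

lemma rank_structureFunctionSwap_le : P.structureFunctionSwap.rank ≤ P.schmidtRank ^ 4 := by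
  obtain ⟨α, β, h⟩ := P.exists_midState_decomposition
  have := rank_productDefect_le P.stateRM (fun x y => (P.stateRM_posSemidef x y).1)
    (fun z x => marginalLeft (α z x))
    (fun z y => Matrix.of fun l l' => ∑ v, β z y (l, v) (l', v)) (by
      intro x y i k l j k' l'
      simp only [stateRM, marginalLeft, Matrix.of_apply, Fintype.sum_prod_type
        (α₁ := Fin P.dimM₀'), h, Finset.sum_mul_sum]
      rw [Finset.sum_congr rfl fun _ _ => Finset.sum_comm, Finset.sum_comm])
  calc _ ≤ _ := this
    _ = _ := by rw [Fintype.card_prod, Fintype.card_fin]; ring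

lemma hasZeroPattern_structureFunction {f : BitString n → BitString n → Bool} {ε : ℝ}
    (hε : ε < 1 / 2) (hP : P.IsCorrect f 0 ε) : HasZeroPattern P.structureFunction f := by
  intro x y
  change productDefect (P.stateRM' x y) = 0 ↔ _
  rw [productDefect_eq_zero_iff (P.stateRM'_posSemidef x y).1]
  constructor
  · intro h
    by_contra hf
    obtain ⟨D, hD⟩ := (hP x y).2 (by simpa using hf)
    rw [fidelity_of_isDecoupled (P.stateRM'_posSemidef x y) (P.trace_stateRM' x y) h] at hD
    linarith
  · intro hf
    obtain ⟨D, hD⟩ := (hP x y).1 hf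
    rw [sub_zero] at hD
    exact isDecoupled_marginalRight (P.midState_posSemidef x y) (P.trace_midState x y) D hD

lemma hasZeroPattern_structureFunctionSwap {f : BitString n → BitString n → Bool} {ε : ℝ}
    (hε : ε < 1 / 2) (hP : P.IsCorrect f ε 0) :
    HasZeroPattern P.structureFunctionSwap (fun x y => !f x y) := by
  intro x y
  change productDefect (P.stateRM x y) = 0 ↔ _
  rw [productDefect_eq_zero_iff (P.stateRM_posSemidef x y).1, Bool.not_eq_false']
  constructor
  · intro h
    by_contra hf
    obtain ⟨D, hD⟩ := (hP x y).1 (by simpa using hf)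
    rw [fidelity_of_isDecoupled (P.stateRM_posSemidef x y) (P.trace_stateRM x y) h] at hD
    linarith
  · intro hf
    obtain ⟨D, hD⟩ := (hP x y).2 hf
    rw [sub_zero] at hD
    -- Exchanging M and M' makes Bob the party who recovers.
    exact isDecoupled_marginalRight (swapSnd_posSemidef (P.midState_posSemidef x y))
      ((trace_swapSnd _).trans (P.trace_midState x y)) D hD

end Protocol

/-! ### From ranks to entanglement cost -/

lemma quarter_logb_le_of_le_pow {r d : ℕ} (h : r ≤ d ^ 4) :
    1 / 4 * Real.logb 2 r ≤ Real.logb 2 d := by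
  have hd : 0 ≤ Real.logb 2 (d : ℝ) :=
    div_nonneg (Real.log_natCast_nonneg d) (Real.log_nonneg (by norm_num))
  -- For r = 0 the left side is 0, as `Real.logb 2 0 = 0`.
  rcases Nat.eq_zero_or_pos r with rfl | hr
  · simpa using hd
  · have h1 : Real.logb 2 (r : ℝ) ≤ Real.logb 2 ((d : ℝ) ^ 4) :=
      Real.logb_le_logb_of_le (by norm_num) (by exact_mod_cast hr) (by exact_mod_cast h)
    rw [Real.logb_pow] at h1
    push_cast at h1
    linarith

lemma zeroPatternRank_le {n : ℕ} {g : Matrix (BitString n) (BitString n) ℝ}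
    {h : BitString n → BitString n → Bool} (hg : HasZeroPattern g h) :
    zeroPatternRank h ≤ g.rank :=
  Nat.sInf_le ⟨g, hg, rfl⟩

/-- A bound uniform over correct protocols passes to the infimum; with no such protocol the infimum
is ⊤. -/
lemma zeroPatternRank_bound {n : ℕ} {f h : BitString n → BitString n → Bool} {ε₀ ε₁ : ℝ}
    (hr : ∀ P : Protocol n, P.IsCorrect f ε₀ ε₁ → zeroPatternRank h ≤ P.schmidtRank ^ 4) :
    ((1 / 4 * Real.logb 2 (zeroPatternRank h) : ℝ) : EReal) ≤ entanglementCost f ε₀ ε₁ :=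
  le_iInf₂ fun P hP => EReal.coe_le_coe_iff.2 (quarter_logb_le_of_le_pow (hr P hP))

lemma zeroPatternRank_le_entanglementCost {n : ℕ} (f : BitString n → BitString n → Bool) {ε : ℝ}
    (hε : ε < 1 / 2) :
    ((1 / 4 * Real.logb 2 (zeroPatternRank f) : ℝ) : EReal) ≤ entanglementCost f 0 ε :=
  zeroPatternRank_bound fun P hP =>
    (zeroPatternRank_le (P.hasZeroPattern_structureFunction hε hP)).trans
      P.rank_structureFunction_le

lemma zeroPatternRank_not_le_entanglementCost {n : ℕ} (f : BitString n → BitString n → Bool)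
    {ε : ℝ} (hε : ε < 1 / 2) :
    ((1 / 4 * Real.logb 2 (zeroPatternRank fun x y => !f x y) : ℝ) : EReal)
      ≤ entanglementCost f ε 0 :=
  zeroPatternRank_bound fun P hP =>
    (zeroPatternRank_le (P.hasZeroPattern_structureFunctionSwap hε hP)).trans
      P.rank_structureFunctionSwap_le

end FRouting

theorem mainTheorem1 (n : ℕ) (f : BitString n → BitString n → Bool) :
    -- the structure functions of any protocol have rank at most `d_E ^ 4`
    (∀ P : Protocol n,
      P.structureFunction.rank ≤ P.schmidtRank ^ 4 ∧
      P.structureFunctionSwap.rank ≤ P.schmidtRank ^ 4) ∧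
    -- perfect correctness on zero instances
    (∀ ε₁ : ℝ, ε₁ < 1 / 2 →
      (∀ P : Protocol n, P.IsCorrect f 0 ε₁ →
        HasZeroPattern P.structureFunction f ∧
        1 / 4 * Real.logb 2 P.structureFunction.rank ≤ Real.logb 2 P.schmidtRank ∧
        (entanglementCost f 0 ε₁ = ((Real.logb 2 P.schmidtRank : ℝ) : EReal) →
          ((1 / 4 * Real.logb 2 P.structureFunction.rank : ℝ) : EReal)
            ≤ entanglementCost f 0 ε₁)) ∧
      ((1 / 4 * Real.logb 2 (zeroPatternRank f) : ℝ) : EReal) ≤ entanglementCost f 0 ε₁) ∧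
    -- perfect correctness on one instances
    (∀ ε₀ : ℝ, ε₀ < 1 / 2 →
      (∀ P : Protocol n, P.IsCorrect f ε₀ 0 →
        HasZeroPattern P.structureFunctionSwap (fun x y => !f x y) ∧
        1 / 4 * Real.logb 2 P.structureFunctionSwap.rank ≤ Real.logb 2 P.schmidtRank ∧
        (entanglementCost f ε₀ 0 = ((Real.logb 2 P.schmidtRank : ℝ) : EReal) →
          ((1 / 4 * Real.logb 2 P.structureFunctionSwap.rank : ℝ) : EReal)
            ≤ entanglementCost f ε₀ 0)) ∧
      ((1 / 4 * Real.logb 2 (zeroPatternRank fun x y => !f x y) : ℝ) : EReal)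
        ≤ entanglementCost f ε₀ 0) ∧
    -- the two boxed bounds
    ((1 / 4 * Real.logb 2 (zeroPatternRank f) : ℝ) : EReal) ≤ FR₀ f ∧
    ((1 / 4 * Real.logb 2 (zeroPatternRank fun x y => !f x y) : ℝ) : EReal) ≤ FR₁ f := by
  refine ⟨fun P => ⟨P.rank_structureFunction_le, P.rank_structureFunctionSwap_le⟩,
    fun ε hε => ⟨fun P hP => ?_, zeroPatternRank_le_entanglementCost f hε⟩,
    fun ε hε => ⟨fun P hP => ?_, zeroPatternRank_not_le_entanglementCost f hε⟩,
    zeroPatternRank_le_entanglementCost f (by norm_num),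
    zeroPatternRank_not_le_entanglementCost f (by norm_num)⟩
  · have h := quarter_logb_le_of_le_pow P.rank_structureFunction_le
    exact ⟨P.hasZeroPattern_structureFunction hε hP, h,
      fun hopt => hopt ▸ EReal.coe_le_coe_iff.2 h⟩
  · have h := quarter_logb_le_of_le_pow P.rank_structureFunctionSwap_le
    exact ⟨P.hasZeroPattern_structureFunctionSwap hε hP, h,
      fun hopt => hopt ▸ EReal.coe_le_coe_iff.2 h⟩
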